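/- Let $r\ge 2$ and $l\ge 2(r+1)$ be integers. The hyperweb ${}^r\overline{W}_l^{\,r}$ is the $r$-uniform hypergraph on $l$ vertices placed in a cycle whose edges are exactly the $r$-element sets of vertices contained in some $r+1$ cyclically consecutive vertices. For an $r$-uniform hypergraph $G$, an $a$-clique of $G$ is a set of $a$ vertices all of whose $r$-element subsets are edges of $G$; let $\mathscr{Q}^{a}_{G}$ denote the set of all $a$-cliques of $G$. The Turán polytope $T(G,a,r)\subseteq\mathbb{R}^{E(G)}$ is the convex hull of the characteristic vectors of all edge sets $F\subseteq E(G)$ that contain no $a$-clique. For $x\in\mathbb{R}^{E(G)}$ and a clique $Q$ of $G$, let $x(Q)$ be the sum of $x_e$ over the edges $e$ contained in $Q$, and let $x(G)=\sum_{e\in E(G)}x_e$. Theorem. With $W={}^r\overline{W}_l^{\,r}$, $$T(W,r+1,r)=\Big\{x\in\mathbb{R}^{E(W)}\ :\ x(Q)\le r\ \ \forall Q\in\mathscr{Q}^{r+1}_{W},\quad x(W)\le r\,l-\Big\lceil\frac{l}{2}\Big\rceil,\quad 0\le x_e\le 1\ \ \forall e\in E(W)\Big\}.$$ Moreover, if $l$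 is odd, all of these inequalities are necessary: for each single inequality of the system (each clique inequality, the hyperweb inequality, each inequality $x_e\ge 0$, and each inequality $x_e\le 1$) there is a point outside $T(W,r+1,r)$ that satisfies all the other inequalities. -/

import Mathlib

/-- An `r`-uniform hypergraph on the vertex set `V`, with finitely many edges. -/
structure UniformHypergraph (V : Type*) (r : ℕ) where
  edges : Finset (Finset V)
  card_of_mem : ∀ e ∈ edges, e.card = r

namespace UniformHypergraph

/-- The (vertex sets of) hypercliques of size `i` in `H`: the `i`-sets of vertices all of whose
`r`-subsets are edges of `H`. -/
def cliques {V : Type*} {r : ℕ} (H : UniformHypergraph V r) (i : ℕ) : Set (Finset V) :=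
  {Q | Q.card = i ∧ Finset.powersetCard r Q ⊆ H.edges}

/-- `x(S)`: the sum of `x_e` over the edges `e` of `H` whose vertices all lie in `S`. -/
def edgeSum {V : Type*} [DecidableEq V] {r : ℕ} (H : UniformHypergraph V r)
    (x : H.edges → ℝ) (S : Finset V) : ℝ :=
  ∑ e : H.edges, if (e : Finset V) ⊆ S then x e else 0

/-- The Turán polytope `T(H, a, r)`, in the space `ℝ^E(H)`: the convex hull of the characteristic
vectors of the edge sets `F ⊆ E(H)` that contain no hyperclique of size `a`. -/
def turanPolytope {V : Type*} [DecidableEq V] {r : ℕ} (H : UniformHypergraph V r) (a : ℕ) :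
    Set (H.edges → ℝ) :=
  convexHull ℝ {x | ∃ F : UniformHypergraph V r, F.edges ⊆ H.edges ∧ F.cliques a = ∅ ∧
    x = fun e : H.edges => if (e : Finset V) ∈ F.edges then 1 else 0}

end UniformHypergraph

/-- The `a` cyclically consecutive vertices `i, i + 1, …, i + (a - 1)` (modulo `l`) on the cycle
with vertex set `Fin l`. -/
def cyclicInterval (l a : ℕ) (i : Fin l) : Finset (Fin l) :=
  Finset.univ.filter fun v => ∃ j < a, v.val = (i.val + j) % l

/-- The hyperweb with parameters `r`, `l`, `m = a - 1`: the `r`-uniform hypergraph on `l` vertices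
placed in a cycle whose edges are the `r`-sets contained in some `a = m + 1` cyclically
consecutive vertices. -/
def hyperweb (r l m : ℕ) : UniformHypergraph (Fin l) r where
  edges := (Finset.powersetCard r Finset.univ).filter fun e =>
    ∃ i : Fin l, e ⊆ cyclicInterval l (m + 1) i
  card_of_mem _ he := (Finset.mem_powersetCard.mp (Finset.mem_filter.mp he).1).2

/-- The individual inequalities of the linear description of `T(W, r + 1, r)`, where `W` is the
hyperweb with parameters `r`, `l`, `m = r`. -/
inductive HyperwebInequality (r l : ℕ) : Type
  | clique (Q : Finset (Fin l)) (hQ : Q ∈ (hyperweb r l r).cliques (r + 1))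
  | web
  | nonneg (e : (hyperweb r l r).edges)
  | edge (e : (hyperweb r l r).edges)

/-- The point `x` satisfies the given inequality. -/
def HyperwebInequality.Holds {r l : ℕ} (x : (hyperweb r l r).edges → ℝ) :
    HyperwebInequality r l → Prop
  | .clique Q _ => (hyperweb r l r).edgeSum x Q ≤ r
  | .web => ∑ e, x e ≤ (r : ℝ) * l - ⌈(l : ℝ) / 2⌉
  | .nonneg e => 0 ≤ x e
  | .edge e => x e ≤ 1

/-! Apart from the octahedron (`r = 2`, `l = 6`), the `(r + 1)`-cliques are the `l` cyclic
intervals. Each consists of two shared edges (sets of `r` consecutive vertices), each shared with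
one neighbouring interval, and `r - 1` private edges lying in no other interval. So the problem
lives on a cycle of cliques.

Validity is a rounding argument: adding all clique inequalities and the bounds `x_e ≤ 1` on private
edges gives `2 x(W) ≤ (2r - 1) l`, and integrality rounds this when `l` is odd.

For the converse it suffices to treat extreme points of the polyhedron, and integral ones are
clearly in the Turán polytope. If the hyperweb inequality is redundant (`l` even) or strict, the
tight cliques determine the fractional coordinates. Every edge lies in at most two cliques, and a
tight clique meeting the fractional support contains at least two fractional edges; counting turns
both bounds into equalities and makes the incidence matrix square and invertible
(`card_eq_of_injective_incidence`). For `l` even the cliques can be signed alternately, a relation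
between the rows that forces empty support; the octahedron is handled likewise with its eight faces.
For `l` odd a nonempty support consists of all shared edges with every clique tight, and then `x(W)`
exceeds the hyperweb bound.

If `l` is odd and the hyperweb inequality is tight, the slacks of the clique inequalities and of the
private upper bounds sum to 1. They are barycentric coordinates of `x` with respect to `r * l`
explicit integral points (`webVertexCoord`). -/

/-! ### Linear algebra and counting on fractional supports -/

/-- If a system of linear equations indexed by `T`, whose coefficients are the incidences with the
sets `inc n`, determines all functions supported on `F`, and if every element of `F` occurs in at
most two equations and every equation involves at least two elements of `F`, then all of these
inequalities are equalities. -/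
theorem card_eq_of_injective_incidence {E N : Type*} [Fintype E] [DecidableEq E]
    [DecidableEq N] (inc : N → Finset E) (F : Finset E) (T : Finset N)
    (h2 : ∀ e ∈ F, (T.filter fun n => e ∈ inc n).card ≤ 2)
    (hT : ∀ n ∈ T, 2 ≤ (F.filter fun e => e ∈ inc n).card)
    (hinj : ∀ d : E → ℝ, (∀ e ∉ F, d e = 0) → (∀ n ∈ T, ∑ e ∈ inc n, d e = 0) → d = 0) :
    (∀ e ∈ F, (T.filter fun n => e ∈ inc n).card = 2) ∧
      (∀ n ∈ T, (F.filter fun e => e ∈ inc n).card = 2) ∧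
      ∀ ε : N → ℝ, (∀ n, ε n ≠ 0) →
        (∀ e ∈ F, ∑ n ∈ T.filter fun n => e ∈ inc n, ε n = 0) → F = ∅ := by
  classical
  let L : (F → ℝ) →ₗ[ℝ] (T → ℝ) :=
    { toFun := fun d n => ∑ e : F, if (e : E) ∈ inc n then d e else 0
      map_add' := fun a b => by
        ext n
        simp only [Pi.add_apply, ← Finset.sum_add_distrib]
        exact Finset.sum_congr rfl fun e _ => by split_ifs <;> simp
      map_smul' := fun c a => by
        ext n
        simp [Finset.mul_sum] }
  have hLinj : Function.Injective L := by
    rw [← LinearMap.ker_eq_bot, LinearMap.ker_eq_bot']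
    intro d hd
    have h0 := hinj (fun e => if h : e ∈ F then d ⟨e, h⟩ else 0) (fun e he => by simp [he])
      (fun n hn => by
        have h1 : ∑ e : F, (if (e : E) ∈ inc n then d e else 0) = 0 := congrFun hd ⟨n, hn⟩
        have h2 : ∑ e : F, (if (e : E) ∈ inc n then d e else 0)
            = ∑ e ∈ F, if e ∈ inc n then (if h : e ∈ F then d ⟨e, h⟩ else 0) else 0 := by
          rw [← Finset.sum_coe_sort F]
          exact Finset.sum_congr rfl fun e _ => by simp
        rw [h2, ← Finset.sum_filter, Finset.filter_mem_eq_inter] at h1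
        refine Eq.trans ?_ h1
        refine (Finset.sum_subset (Finset.inter_subset_right : F ∩ inc n ⊆ inc n) fun e he he' => ?_).symm
        have : e ∉ F := fun h => he' (Finset.mem_inter.2 ⟨h, he⟩)
        simp [this])
    ext e
    simpa using congrFun h0 e
  have hcard : F.card ≤ T.card := by
    simpa using LinearMap.finrank_le_finrank_of_injective hLinj
  have hdc : ∑ n ∈ T, (F.filter fun e => e ∈ inc n).card
      = ∑ e ∈ F, (T.filter fun n => e ∈ inc n).card := by
    simp only [Finset.card_filter]
    exact Finset.sum_comm
  have hlow : ∑ n ∈ T, 2 ≤ ∑ n ∈ T, (F.filter fun e => e ∈ inc n).card := Finset.sum_le_sum hT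
  have hup : ∑ e ∈ F, (T.filter fun n => e ∈ inc n).card ≤ ∑ e ∈ F, 2 := Finset.sum_le_sum h2
  simp only [Finset.sum_const, smul_eq_mul] at hlow hup
  -- Injectivity gives `|F| ≤ |T|`; counting incidences gives `2|T| ≤ 2|F|`.
  have hFT : F.card = T.card := by omega
  refine ⟨?_, ?_, ?_⟩
  · refine (Finset.sum_eq_sum_iff_of_le h2).1 ?_
    simp only [Finset.sum_const, smul_eq_mul]
    omega
  · intro n hn
    refine ((Finset.sum_eq_sum_iff_of_le hT).1 ?_ n hn).symm
    simp only [Finset.sum_const, smul_eq_mul]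
    omega
  · intro ε hε hsum
    by_contra hF
    have hTpos : 0 < T.card := hFT ▸ Finset.card_pos.2 (Finset.nonempty_iff_ne_empty.2 hF)
    obtain ⟨n, hn⟩ := Finset.card_pos.1 hTpos
    have hsurj : Function.Surjective L :=
      (LinearMap.injective_iff_surjective_of_finrank_eq_finrank (by simpa using hFT)).1 hLinj
    -- The functional `ε` kills the range of `L`, yet `L` is onto: test it on a preimage of a unit
    -- vector.
    obtain ⟨d, hd⟩ := hsurj (Pi.single ⟨n, hn⟩ 1)
    have h1 : ∑ m : T, ε m * L d m = ε n := by
      rw [hd]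
      simp [Pi.single_apply]
    have h3 : ∑ m : T, ε m * L d m = 0 := by
      have h4 : ∀ m : T, ε m * L d m = ∑ e : F, if (e : E) ∈ inc m then ε m * d e else 0 := by
        intro m
        simp [L, Finset.mul_sum]
      simp_rw [h4]
      rw [Finset.sum_comm]
      refine Finset.sum_eq_zero fun e _ => ?_
      have h5 := hsum e e.2
      rw [Finset.sum_filter, ← Finset.sum_coe_sort T] at h5
      have h6 : (∑ m : T, if (e : E) ∈ inc m then ε m else 0) * d e = 0 := by rw [h5, zero_mul]
      refine Eq.trans ?_ h6
      rw [Finset.sum_mul]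
      exact Finset.sum_congr rfl fun m _ => by rw [ite_mul, zero_mul]
    exact hε n (h1.symm.trans h3)

/-- If a sum of elements of `[0, 1]` is an integer, then it does not have exactly one
fractional term. -/
theorem two_le_card_fractional {E : Type*} (S : Finset E) (x : E → ℝ)
    (b : ℤ) (hS : ∑ e ∈ S, x e = b) (p : E → Prop) [DecidablePred p]
    (hp : ∀ e, ¬ p e → x e = 0 ∨ x e = 1) (hp' : ∀ e, p e → 0 < x e ∧ x e < 1)
    (hne : (S.filter p).Nonempty) : 2 ≤ (S.filter p).card := by
  classical
  by_contra hlt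
  have h1 : (S.filter p).card = 1 := by
    have := hne.card_pos
    omega
  obtain ⟨e, he⟩ := Finset.card_eq_one.1 h1
  have h2 : ∑ a ∈ S.filter (fun a => ¬ p a), x a
      = ((∑ a ∈ S.filter (fun a => ¬ p a), if x a = 0 then (0 : ℤ) else 1 : ℤ) : ℝ) := by
    push_cast
    refine Finset.sum_congr rfl fun a ha => ?_
    rcases hp a (Finset.mem_filter.1 ha).2 with h | h <;> simp [h]
  have h3 := Finset.sum_filter_add_sum_filter_not S p x
  rw [he, Finset.sum_singleton, h2, hS] at h3
  have h4 := hp' e (Finset.mem_filter.1 (he ▸ Finset.mem_singleton_self e : e ∈ S.filter p)).2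
  have h5 : x e = ((b - ∑ a ∈ S.filter (fun a => ¬ p a), (if x a = 0 then (0 : ℤ) else 1) : ℤ) : ℝ) := by
    rw [Int.cast_sub]
    linarith
  rw [h5] at h4
  generalize b - _ = c at h4
  have h6 : 0 < c := by exact_mod_cast h4.1
  have h7 : c < 1 := by exact_mod_cast h4.2
  omega

/-! ### Cyclic intervals and coordinates for the edges -/

/-- The vertex `k` steps after `i` on the cycle. -/
def cyclicShift {l : ℕ} (i : Fin l) (k : ℕ) : Fin l :=
  ⟨(i.val + k) % l, Nat.mod_lt _ i.pos⟩

theorem val_cyclicShift {l : ℕ} (i : Fin l) {k : ℕ} (hk : k ≤ l) :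
    (cyclicShift i k).val = if i.val + k < l then i.val + k else i.val + k - l := by
  have hi := i.isLt
  simp only [cyclicShift]
  split_ifs with h
  · exact Nat.mod_eq_of_lt h
  · rw [Nat.mod_eq_sub_mod (by omega), Nat.mod_eq_of_lt (by omega)]

theorem val_sub_one_cycle {l : ℕ} [NeZero l] (hl : 2 ≤ l) (i : Fin l) :
    (i - 1).val = if i.val = 0 then l - 1 else i.val - 1 := by
  obtain ⟨n, rfl⟩ : ∃ n, l = n + 1 := ⟨l - 1, by omega⟩
  rw [Fin.coe_sub_one]
  have h : i = 0 ↔ i.val = 0 := Fin.ext_iff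
  simp only [h]
  rfl

theorem mem_cyclicInterval {l a : ℕ} (ha : a ≤ l) (i v : Fin l) :
    v ∈ cyclicInterval l a i ↔ (i.val ≤ v.val ∧ v.val < i.val + a) ∨ v.val + l < i.val + a := by
  have hi := i.isLt
  have hv := v.isLt
  simp only [cyclicInterval, Finset.mem_filter, Finset.mem_univ, true_and]
  constructor
  · rintro ⟨j, hj, h⟩
    rcases lt_or_ge (i.val + j) l with h1 | h1
    · rw [Nat.mod_eq_of_lt h1] at h
      omega
    · rw [Nat.mod_eq_sub_mod h1, Nat.mod_eq_of_lt (by omega)] at h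
      omega
  · rintro (h | h)
    · exact ⟨v - i, by omega, by rw [Nat.mod_eq_of_lt (by omega)]; omega⟩
    · refine ⟨v + l - i, by omega, ?_⟩
      rw [show i.val + (v.val + l - i.val) = v.val + l by omega, Nat.add_mod_right,
        Nat.mod_eq_of_lt hv]

theorem cyclicInterval_eq_image {l a : ℕ} (i : Fin l) :
    cyclicInterval l a i = (Finset.range a).image (cyclicShift i) := by
  ext v
  simp [cyclicInterval, cyclicShift, Fin.ext_iff, eq_comm]

theorem cyclicShift_injOn {l : ℕ} (i : Fin l) {j k : ℕ} (hj : j < l) (hk : k < l)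
    (h : cyclicShift i j = cyclicShift i k) : j = k := by
  have h1 := congrArg Fin.val h
  rw [val_cyclicShift i hj.le, val_cyclicShift i hk.le] at h1
  have hi := i.isLt
  split_ifs at h1 <;> omega

theorem card_cyclicInterval {l a : ℕ} (ha : a ≤ l) (i : Fin l) :
    (cyclicInterval l a i).card = a := by
  rw [cyclicInterval_eq_image, Finset.card_image_of_injOn, Finset.card_range]
  intro j hj k hk h
  simp only [Finset.coe_range, Set.mem_Iio] at hj hk
  exact cyclicShift_injOn i (by omega) (by omega) h

theorem cyclicShift_mem_cyclicInterval {l a k : ℕ} (hk : k < a) (i : Fin l) :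
    cyclicShift i k ∈ cyclicInterval l a i := by
  rw [cyclicInterval_eq_image]
  exact Finset.mem_image_of_mem _ (Finset.mem_range.2 hk)

theorem mem_edges_hyperweb {r l m : ℕ} {e : Finset (Fin l)} :
    e ∈ (hyperweb r l m).edges ↔ e.card = r ∧ ∃ i, e ⊆ cyclicInterval l (m + 1) i := by
  simp [hyperweb]

/-- The set of the `r + 1` vertices `i, …, i + r` without the vertex `i + k`. -/
def webEdge (r l : ℕ) (i : Fin l) (k : ℕ) : Finset (Fin l) :=
  (cyclicInterval l (r + 1) i).erase (cyclicShift i k)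

theorem webEdge_mem {r l : ℕ} (hl : r + 1 ≤ l) (i : Fin l) {k : ℕ} (hk : k ≤ r) :
    webEdge r l i k ∈ (hyperweb r l r).edges := by
  refine mem_edges_hyperweb.2 ⟨?_, i, Finset.erase_subset _ _⟩
  rw [webEdge, Finset.card_erase_of_mem (cyclicShift_mem_cyclicInterval (by omega) i),
    card_cyclicInterval hl]
  rfl

theorem mem_webEdge {r l : ℕ} {i v : Fin l} {k : ℕ} :
    v ∈ webEdge r l i k ↔ v ≠ cyclicShift i k ∧ v ∈ cyclicInterval l (r + 1) i :=
  Finset.mem_erase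

/-- This is the edge shared by two neighbouring intervals. Giving it the position 0 of the earlier
one makes the coordinates with `k < r` unique. -/
theorem webEdge_self {r l : ℕ} [NeZero l] (hr : 1 ≤ r) (hl : r + 2 ≤ l) (i : Fin l) :
    webEdge r l i r = webEdge r l (i - 1) 0 := by
  ext v
  have hi := i.isLt
  have hv := v.isLt
  have h1 := val_sub_one_cycle (by omega) i
  have h2 := val_cyclicShift i (k := r) (by omega)
  have h3 := val_cyclicShift (i - 1) (k := 0) (by omega)
  simp only [mem_webEdge, mem_cyclicInterval (show r + 1 ≤ l by omega), ne_eq, Fin.ext_iff]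
  rw [h2, h3, h1]
  split_ifs <;> omega

/-- The extreme remaining positions are `r` and either 0 or, if `k = 0`, 1. Since `l ≥ 2(r + 1)`, an
interval cannot reach both the other way round, so its start is forced, up to one step when `k = 0`.
-/
theorem webEdge_subset_iff {r l : ℕ} [NeZero l] (hr : 2 ≤ r) (hl : 2 * (r + 1) ≤ l)
    (i j : Fin l) {k : ℕ} (hk : k < r) :
    webEdge r l i k ⊆ cyclicInterval l (r + 1) j ↔ i = j ∨ (i = j - 1 ∧ k = 0) := by
  constructor
  · intro h
    have hi := i.isLt
    have hj := j.isLt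
    have h1 := val_sub_one_cycle (by omega) j
    have hs := fun s => val_cyclicShift i (k := s)
    have hsk := hs k (by omega)
    have key : ∀ s, s ≤ r → s ≠ k → cyclicShift i s ∈ cyclicInterval l (r + 1) j := fun s hs hsk =>
      h (mem_webEdge.2 ⟨fun h' => hsk (cyclicShift_injOn i (by omega) (by omega) h'),
        cyclicShift_mem_cyclicInterval (by omega) i⟩)
    have h2 := key r le_rfl (by omega)
    rw [mem_cyclicInterval (by omega), hs r (by omega)] at h2
    simp only [Fin.ext_iff, h1]
    rcases Nat.eq_zero_or_pos k with h0 | h0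
    · have h3 := key 1 (by omega) (by omega)
      rw [mem_cyclicInterval (by omega), hs 1 (by omega)] at h3
      split_ifs at h2 h3 ⊢ <;> omega
    · have h3 := key 0 (by omega) (by omega)
      rw [mem_cyclicInterval (by omega), hs 0 (by omega)] at h3
      split_ifs at h2 h3 ⊢ <;> omega
  · rintro (rfl | ⟨rfl, rfl⟩)
    · exact Finset.erase_subset _ _
    · rw [← webEdge_self (by omega) (by omega)]
      exact Finset.erase_subset _ _

theorem exists_eq_webEdge {r l : ℕ} [NeZero l] (hr : 2 ≤ r) (hl : 2 * (r + 1) ≤ l)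
    {e : Finset (Fin l)} (he : e ∈ (hyperweb r l r).edges) :
    ∃ i, ∃ k < r, e = webEdge r l i k := by
  obtain ⟨hc, i, hi⟩ := mem_edges_hyperweb.1 he
  have h1 : (cyclicInterval l (r + 1) i \ e).card = 1 := by
    rw [Finset.card_sdiff_of_subset hi, card_cyclicInterval (by omega), hc]
    omega
  obtain ⟨v, hv⟩ := Finset.card_eq_one.1 h1
  have h2 : e = (cyclicInterval l (r + 1) i).erase v := by
    rw [← Finset.sdiff_singleton_eq_erase, ← hv, Finset.sdiff_sdiff_eq_self hi]
  have h3 : v ∈ cyclicInterval l (r + 1) i :=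
    (Finset.mem_sdiff.1 (hv ▸ Finset.mem_singleton_self v)).1
  rw [cyclicInterval_eq_image] at h3
  obtain ⟨k, hk, rfl⟩ := Finset.mem_image.1 h3
  rw [Finset.mem_range] at hk
  rcases Nat.lt_or_ge k r with h | h
  · exact ⟨i, k, h, h2⟩
  · obtain rfl : k = r := by omega
    exact ⟨i - 1, 0, by omega, h2.trans (webEdge_self (by omega) (by omega) i)⟩

theorem webEdge_inj {r l : ℕ} [NeZero l] (hr : 2 ≤ r) (hl : 2 * (r + 1) ≤ l)
    {i j : Fin l} {k m : ℕ} (hk : k < r) (hm : m < r) (h : webEdge r l i k = webEdge r l j m) :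
    i = j ∧ k = m := by
  have h1 := (webEdge_subset_iff hr hl i j hk).1 (h.trans_subset (Finset.erase_subset _ _))
  have h2 := (webEdge_subset_iff hr hl j i hm).1 (h.symm.trans_subset (Finset.erase_subset _ _))
  have h3 := val_sub_one_cycle (by omega) j
  have h4 := val_sub_one_cycle (by omega) i
  have hij : i = j := by
    simp only [Fin.ext_iff, h3, h4] at h1 h2 ⊢
    split_ifs at h1 h2 <;> omega
  subst hij
  refine ⟨rfl, ?_⟩
  by_contra hne
  have h5 : cyclicShift i k ∈ webEdge r l i m :=
    mem_webEdge.2 ⟨fun h' => hne (cyclicShift_injOn i (by omega) (by omega) h'),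
      cyclicShift_mem_cyclicInterval (by omega) i⟩
  rw [← h] at h5
  exact (mem_webEdge.1 h5).1 rfl

/-- The edges of the hyperweb, indexed by the first vertex of an interval of length `r + 1` and
the position of the missing vertex, which is not the last one. -/
noncomputable def webEdgeEquiv {r l : ℕ} [NeZero l] (hr : 2 ≤ r) (hl : 2 * (r + 1) ≤ l) :
    Fin l × Fin r ≃ (hyperweb r l r).edges :=
  Equiv.ofBijective (fun p => ⟨webEdge r l p.1 p.2, webEdge_mem (by omega) p.1 p.2.isLt.le⟩)
    ⟨fun p q h => by
      have h1 := webEdge_inj hr hl p.2.isLt q.2.isLt (congrArg Subtype.val h)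
      exact Prod.ext h1.1 (Fin.ext h1.2),
    fun e => by
      obtain ⟨i, k, hk, h⟩ := exists_eq_webEdge hr hl e.2
      exact ⟨(i, ⟨k, hk⟩), Subtype.ext h.symm⟩⟩

theorem coe_webEdgeEquiv {r l : ℕ} [NeZero l] (hr : 2 ≤ r) (hl : 2 * (r + 1) ≤ l)
    (p : Fin l × Fin r) : (webEdgeEquiv hr hl p : Finset (Fin l)) = webEdge r l p.1 p.2 := rfl

/-! ### Classification of the cliques -/

theorem cyclicInterval_mem_cliques {r l : ℕ} (hl : r + 1 ≤ l) (i : Fin l) :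
    cyclicInterval l (r + 1) i ∈ (hyperweb r l r).cliques (r + 1) := by
  refine ⟨card_cyclicInterval hl i, fun e he => ?_⟩
  rw [Finset.mem_powersetCard] at he
  exact mem_edges_hyperweb.2 ⟨he.2, i, he.1⟩

/-- Apart from the octahedron, the cliques of the hyperweb are the cyclic intervals. -/
theorem exists_eq_cyclicInterval {r l : ℕ} [NeZero l] (hr : 2 ≤ r) (hl : 2 * (r + 1) ≤ l)
    (hex : ¬ (r = 2 ∧ l = 6)) {Q : Finset (Fin l)}
    (hQ : Q ∈ (hyperweb r l r).cliques (r + 1)) : ∃ i, Q = cyclicInterval l (r + 1) i := by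
  obtain ⟨hc, hQe⟩ := hQ
  obtain ⟨e, heQ, hec⟩ := Finset.exists_subset_card_eq (show r ≤ Q.card by omega)
  have he := hQe (Finset.mem_powersetCard.2 ⟨heQ, hec⟩)
  obtain ⟨i, k, hk, rfl⟩ := exists_eq_webEdge hr hl he
  have h1 : (Q \ webEdge r l i k).card = 1 := by
    rw [Finset.card_sdiff_of_subset heQ]
    omega
  obtain ⟨v, hv⟩ := Finset.card_eq_one.1 h1
  have hvQ : v ∈ Q ∧ v ∉ webEdge r l i k :=
    Finset.mem_sdiff.1 (hv ▸ Finset.mem_singleton_self v)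
  have hQv : Q = insert v (webEdge r l i k) := by
    rw [Finset.insert_eq, ← hv, Finset.sdiff_union_of_subset heQ]
  by_cases hvi : v ∈ cyclicInterval l (r + 1) i
  · refine ⟨i, Finset.eq_of_subset_of_card_le ?_ ?_⟩
    · rw [hQv]
      exact Finset.insert_subset hvi (Finset.erase_subset _ _)
    · rw [hc, card_cyclicInterval (by omega)]
  have hs := fun s => val_cyclicShift i (k := s)
  have hmem : ∀ s, s ≤ r → s ≠ k → cyclicShift i s ∈ Q := fun s hs hsk =>
    heQ (mem_webEdge.2 ⟨fun h' => hsk (cyclicShift_injOn i (by omega) (by omega) h'),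
      cyclicShift_mem_cyclicInterval (by omega) i⟩)
  have hne : ∀ s, s ≤ r → v ≠ cyclicShift i s := fun s hs h =>
    hvi (h ▸ cyclicShift_mem_cyclicInterval (by omega) i)
  have hrm : ∀ w ∈ Q, ∃ j, Q.erase w ⊆ cyclicInterval l (r + 1) j := fun w hw =>
    (mem_edges_hyperweb.1 (hQe (Finset.mem_powersetCard.2 ⟨Finset.erase_subset _ _, by
      rw [Finset.card_erase_of_mem hw, hc]; rfl⟩))).2
  have hi := i.isLt
  have hvl := v.isLt
  rw [mem_cyclicInterval (by omega)] at hvi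
  -- it suffices that `v` is the vertex following an edge of consecutive vertices
  suffices h : k = 0 ∧ v = cyclicShift i (r + 1) by
    obtain ⟨rfl, rfl⟩ := h
    refine ⟨cyclicShift i 1, Finset.eq_of_subset_of_card_le ?_ ?_⟩
    · rw [hQv]
      have h1 := hs 1 (by omega)
      have h2 := hs (r + 1) (by omega)
      have h0 := hs 0 (by omega)
      intro w hw
      have hwl := w.isLt
      simp only [Finset.mem_insert, mem_webEdge, mem_cyclicInterval (show r + 1 ≤ l by omega),
        Fin.ext_iff, ne_eq] at hw ⊢
      rw [h1]
      rw [h2, h0] at hw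
      split_ifs at hw ⊢ <;> omega
    · rw [hc, card_cyclicInterval (by omega)]
  have pos : ∀ s, s ≤ r → ∀ j : Fin l, cyclicShift i s ∈ cyclicInterval l (r + 1) j →
      (j.val ≤ i.val + s ∧ i.val + s < j.val + (r + 1)) ∨
      (j.val + l ≤ i.val + s ∧ i.val + s < j.val + l + (r + 1)) ∨
      i.val + s + l < j.val + (r + 1) := by
    intro s hsr j hj
    rw [mem_cyclicInterval (by omega), hs s (by omega)] at hj
    have := j.isLt
    split_ifs at hj <;> omega
  have key : ∀ s t, s ≤ r → t ≤ r → s ≠ k → t ≠ k → s ≠ t →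
      (∀ p, p ≤ r → p ≠ k → p ≠ s → p ≠ t → ∃ j,
        cyclicShift i s ∈ cyclicInterval l (r + 1) j ∧
        cyclicShift i t ∈ cyclicInterval l (r + 1) j ∧ v ∈ cyclicInterval l (r + 1) j) ∧
      ∃ j, cyclicShift i s ∈ cyclicInterval l (r + 1) j ∧
        v ∈ cyclicInterval l (r + 1) j := by
    intro s t hs' ht hsk htk hst
    constructor
    · intro p hp hpk hps hpt
      obtain ⟨j, hj⟩ := hrm _ (hmem p hp hpk)
      exact ⟨j, hj (Finset.mem_erase.2 ⟨fun h => hps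
        (cyclicShift_injOn i (by omega) (by omega) h).symm, hmem s hs' hsk⟩),
        hj (Finset.mem_erase.2 ⟨fun h => hpt
        (cyclicShift_injOn i (by omega) (by omega) h).symm, hmem t ht htk⟩),
        hj (Finset.mem_erase.2 ⟨hne p hp, hvQ.1⟩)⟩
    · obtain ⟨j, hj⟩ := hrm _ (hmem t ht htk)
      exact ⟨j, hj (Finset.mem_erase.2 ⟨fun h => hst
        (cyclicShift_injOn i (by omega) (by omega) h), hmem s hs' hsk⟩),
        hj (Finset.mem_erase.2 ⟨hne t ht, hvQ.1⟩)⟩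
  rw [Fin.ext_iff, hs (r + 1) (by omega)]
  -- Position `a` is the first vertex of the edge; position `r` is its last one, as `k < r`.
  obtain ⟨a, ha, hak⟩ : ∃ a, a = (if k = 0 then 1 else 0) ∧ a ≠ k :=
    ⟨_, rfl, by split_ifs <;> omega⟩
  have har : a ≤ 1 ∧ (k = 0 → a = 1) ∧ (k ≠ 0 → a = 0) := by split_ifs at ha <;> omega
  clear ha
  rcases Nat.lt_or_ge 2 r with h3 | h3
  -- For `r ≥ 3` a third vertex `p` of the edge can be dropped, so one interval contains both ends
  -- of the edge and `v`.
  · obtain ⟨p, hp⟩ : ∃ p, p = if k ≤ 1 then 2 else 1 := ⟨_, rfl⟩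
    obtain ⟨j, hj1, hj2, hj3⟩ := (key a r (by omega) le_rfl hak (by omega) (by omega)).1 p
      (by split_ifs at hp <;> omega) (by split_ifs at hp <;> omega)
      (by split_ifs at hp <;> omega) (by split_ifs at hp <;> omega)
    clear hp
    have h1 := pos a (by omega) j hj1
    have h2 := pos r le_rfl j hj2
    rw [mem_cyclicInterval (by omega)] at hj3
    have := j.isLt
    clear hj1 hj2 hmem hne hrm pos key hs
    split_ifs <;> omega
  · obtain rfl : r = 2 := by omega
    -- For `r = 2` only separate intervals are available, one for `v` with each end; they force the
    -- claim once `l ≥ 7`.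
    obtain ⟨j, hj1, hj3⟩ := (key a 2 (by omega) le_rfl hak (by omega) (by omega)).2
    obtain ⟨m, hm1, hm3⟩ := (key 2 a le_rfl (by omega) (by omega) hak (by omega)).2
    have h1 := pos a (by omega) j hj1
    have h2 := pos 2 le_rfl m hm1
    rw [mem_cyclicInterval (by omega)] at hj3 hm3
    have := j.isLt
    have := m.isLt
    clear hj1 hm1 hmem hne hrm pos key hs
    split_ifs <;> omega

/-! ### Clique inequalities in a general hypergraph -/

namespace UniformHypergraph

theorem edgeSum_eq_sum_filter {V : Type*} [DecidableEq V] {r : ℕ} (H : UniformHypergraph V r)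
    (x : H.edges → ℝ) (S : Finset V) :
    H.edgeSum x S = ∑ e ∈ Finset.univ.filter fun e : H.edges => (e : Finset V) ⊆ S, x e := by
  rw [edgeSum, Finset.sum_filter]

theorem edgeSum_add {V : Type*} [DecidableEq V] {r : ℕ} (H : UniformHypergraph V r)
    (x y : H.edges → ℝ) (S : Finset V) :
    H.edgeSum (x + y) S = H.edgeSum x S + H.edgeSum y S := by
  simp [edgeSum_eq_sum_filter, Finset.sum_add_distrib]

theorem edgeSum_smul {V : Type*} [DecidableEq V] {r : ℕ} (H : UniformHypergraph V r)
    (c : ℝ) (x : H.edges → ℝ) (S : Finset V) :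
    H.edgeSum (c • x) S = c * H.edgeSum x S := by
  simp [edgeSum_eq_sum_filter, Finset.mul_sum]

/-- The sum over a clique of the characteristic vector of an edge set. -/
theorem edgeSum_characteristic {V : Type*} [DecidableEq V] {r a : ℕ} (H : UniformHypergraph V r)
    (F : Finset (Finset V)) {Q : Finset V} (hQ : Q ∈ H.cliques a) :
    H.edgeSum (fun e : H.edges => if (e : Finset V) ∈ F then 1 else 0) Q =
      (((Finset.powersetCard r Q).filter fun e => e ∈ F).card : ℝ) := by
  rw [edgeSum, Finset.sum_coe_sort H.edges (fun e => if e ⊆ Q then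
    (if e ∈ F then (1 : ℝ) else 0) else 0), Finset.card_filter, Nat.cast_sum, ← Finset.sum_filter]
  have h : H.edges.filter (fun e => e ⊆ Q) = Finset.powersetCard r Q := by
    ext e
    rw [Finset.mem_filter, Finset.mem_powersetCard]
    exact ⟨fun h => ⟨h.2, H.card_of_mem e h.1⟩,
      fun h => ⟨hQ.2 (Finset.mem_powersetCard.2 h), h.1⟩⟩
  rw [h]
  simp

/-- The integral points of the clique relaxation lie in the Turán polytope. -/
theorem mem_turanPolytope_of_integral {V : Type*} [DecidableEq V] {r : ℕ}
    (H : UniformHypergraph V r) {x : H.edges → ℝ} (hx : ∀ e, x e = 0 ∨ x e = 1)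
    (hQ : ∀ Q ∈ H.cliques (r + 1), H.edgeSum x Q ≤ r) : x ∈ H.turanPolytope (r + 1) := by
  let F : UniformHypergraph V r :=
    { edges := H.edges.filter fun e => ∃ h : e ∈ H.edges, x ⟨e, h⟩ = 1
      card_of_mem := fun e he => H.card_of_mem e (Finset.mem_filter.1 he).1 }
  have hxF : x = fun e : H.edges => if (e : Finset V) ∈ F.edges then 1 else 0 := by
    ext e
    rcases hx e with h | h <;> simp [F, h]
  refine subset_convexHull ℝ _ ⟨F, Finset.filter_subset _ _, ?_, hxF⟩
  by_contra hne
  obtain ⟨Q, hQF⟩ := Set.nonempty_iff_ne_empty.2 hne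
  have hQH : Q ∈ H.cliques (r + 1) := ⟨hQF.1, hQF.2.trans (Finset.filter_subset _ _)⟩
  have h1 := hQ Q hQH
  rw [hxF, edgeSum_characteristic H _ hQH, Finset.filter_true_of_mem fun e he => hQF.2 he,
    Finset.card_powersetCard, hQF.1, Nat.choose_succ_self_right] at h1
  have h2 : r + 1 ≤ r := by exact_mod_cast h1
  omega

/-- Clique-free edge sets satisfy the clique inequalities. -/
theorem edgeSum_characteristic_le {V : Type*} [DecidableEq V] {r : ℕ}
    (H F : UniformHypergraph V r) (hF : F.cliques (r + 1) = ∅) {Q : Finset V}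
    (hQ : Q ∈ H.cliques (r + 1)) :
    H.edgeSum (fun e : H.edges => if (e : Finset V) ∈ F.edges then 1 else 0) Q ≤ r := by
  rw [edgeSum_characteristic H _ hQ]
  have h1 : ¬ Finset.powersetCard r Q ⊆ F.edges := fun h => by
    have : Q ∈ F.cliques (r + 1) := ⟨hQ.1, h⟩
    simp [hF] at this
  have h2 : ((Finset.powersetCard r Q).filter fun e => e ∈ F.edges).card <
      (Finset.powersetCard r Q).card :=
    Finset.card_lt_card (Finset.filter_ssubset.2 (Finset.not_subset.1 h1))
  rw [Finset.card_powersetCard, hQ.1, Nat.choose_succ_self_right] at h2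
  exact_mod_cast Nat.lt_succ_iff.1 h2

end UniformHypergraph

/-! ### Double counting and the hyperweb bound -/

theorem sum_hyperweb_edges {r l : ℕ} [NeZero l] (hr : 2 ≤ r) (hl : 2 * (r + 1) ≤ l)
    (x : (hyperweb r l r).edges → ℝ) :
    ∑ e, x e = ∑ i : Fin l, ∑ k : Fin r, x (webEdgeEquiv hr hl (i, k)) := by
  rw [← Fintype.sum_prod_type', (webEdgeEquiv hr hl).sum_comp x]

theorem edgeSum_cyclicInterval {r l : ℕ} [NeZero r] [NeZero l] (hr : 2 ≤ r) (hl : 2 * (r + 1) ≤ l)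
    (x : (hyperweb r l r).edges → ℝ) (j : Fin l) :
    (hyperweb r l r).edgeSum x (cyclicInterval l (r + 1) j) =
      ∑ k : Fin r, x (webEdgeEquiv hr hl (j, k)) + x (webEdgeEquiv hr hl (j - 1, 0)) := by
  have hne : j - 1 ≠ j := by
    have h1 := val_sub_one_cycle (by omega) j
    intro h
    rw [h] at h1
    have := j.isLt
    split_ifs at h1 <;> omega
  rw [UniformHypergraph.edgeSum, ← (webEdgeEquiv hr hl).sum_comp, Fintype.sum_prod_type]
  have h2 : ∀ i, ∑ k : Fin r, (if (webEdgeEquiv hr hl (i, k) : Finset (Fin l)) ⊆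
      cyclicInterval l (r + 1) j then x (webEdgeEquiv hr hl (i, k)) else 0) =
      (if i = j then ∑ k : Fin r, x (webEdgeEquiv hr hl (i, k)) else 0) +
      if i = j - 1 then x (webEdgeEquiv hr hl (i, 0)) else 0 := by
    intro i
    simp only [coe_webEdgeEquiv, webEdge_subset_iff hr hl i j (Fin.isLt _)]
    by_cases h : i = j
    · subst h
      simp [hne.symm]
    · by_cases h' : i = j - 1
      · simp only [h', hne, false_or, true_and, if_false, if_true, zero_add]
        rw [Finset.sum_eq_single (0 : Fin r)]
        · simp
        · intro k _ hk
          rw [if_neg fun h => hk (Fin.ext (by simpa using h))]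
        · simp
      · simp [h, h']
  simp_rw [h2, Finset.sum_add_distrib]
  simp

/-- Edges with coordinate `k = 0` lie in two intervals, all others in one. -/
theorem sum_edgeSum_cyclicInterval {r l : ℕ} [NeZero r] [NeZero l] (hr : 2 ≤ r) (hl : 2 * (r + 1) ≤ l)
    (x : (hyperweb r l r).edges → ℝ) :
    ∑ j, (hyperweb r l r).edgeSum x (cyclicInterval l (r + 1) j) =
      ∑ e, x e + ∑ i, x (webEdgeEquiv hr hl (i, 0)) := by
  simp_rw [edgeSum_cyclicInterval hr hl]
  rw [Finset.sum_add_distrib, sum_hyperweb_edges hr hl x]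
  congr 1
  exact (Equiv.subRight (1 : Fin l)).sum_comp fun i => x (webEdgeEquiv hr hl (i, 0))

/-- The hyperweb inequality up to rounding follows from the clique inequalities. -/
theorem two_mul_sum_edges_le {r l : ℕ} [NeZero r] [NeZero l] (hr : 2 ≤ r) (hl : 2 * (r + 1) ≤ l)
    {x : (hyperweb r l r).edges → ℝ}
    (hQ : ∀ j, (hyperweb r l r).edgeSum x (cyclicInterval l (r + 1) j) ≤ r)
    (h1 : ∀ e, x e ≤ 1) : 2 * ∑ e, x e ≤ 2 * ((r : ℝ) * l) - l := by
  have h2 := Finset.sum_le_sum fun j (_ : j ∈ Finset.univ) => hQ j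
  rw [sum_edgeSum_cyclicInterval hr hl] at h2
  simp only [Finset.sum_const, Finset.card_univ, Fintype.card_fin, nsmul_eq_mul] at h2
  have h3 : ∀ i, ∑ k : Fin r, x (webEdgeEquiv hr hl (i, k)) ≤
      x (webEdgeEquiv hr hl (i, 0)) + ((r : ℝ) - 1) := by
    intro i
    rw [← Finset.add_sum_erase _ _ (Finset.mem_univ (0 : Fin r))]
    refine add_le_add_right ((Finset.sum_le_sum fun k _ => h1 _).trans ?_) _
    simp [Finset.card_erase_of_mem, Nat.cast_sub (show 1 ≤ r by omega)]
  have h4 := Finset.sum_le_sum fun i (_ : i ∈ Finset.univ) => h3 i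
  rw [← sum_hyperweb_edges hr hl x, Finset.sum_add_distrib] at h4
  simp only [Finset.sum_const, Finset.card_univ, Fintype.card_fin, nsmul_eq_mul] at h4
  nlinarith

theorem ceil_half_of_even {l : ℕ} (h : Even l) : ((⌈(l : ℝ) / 2⌉ : ℤ) : ℝ) = l / 2 := by
  obtain ⟨m, rfl⟩ := h
  have : ((m + m : ℕ) : ℝ) / 2 = (m : ℤ) := by
    push_cast
    ring
  rw [this, Int.ceil_intCast]

theorem ceil_half_of_odd {l : ℕ} (h : Odd l) : ((⌈(l : ℝ) / 2⌉ : ℤ) : ℝ) = (l + 1) / 2 := by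
  obtain ⟨m, rfl⟩ := h
  have : ⌈((2 * m + 1 : ℕ) : ℝ) / 2⌉ = (m : ℤ) + 1 := by
    rw [Int.ceil_eq_iff]
    push_cast
    constructor <;> linarith
  rw [this]
  push_cast
  ring

/-! ### The polyhedron and its extreme points -/

/-- The polyhedron described by the clique, hyperweb and bound inequalities. -/
def hyperwebPolyhedron (r l : ℕ) : Set ((hyperweb r l r).edges → ℝ) :=
  {x | (∀ Q ∈ (hyperweb r l r).cliques (r + 1), (hyperweb r l r).edgeSum x Q ≤ r) ∧
          ∑ e, x e ≤ (r : ℝ) * l - ⌈(l : ℝ) / 2⌉ ∧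
          ∀ e, 0 ≤ x e ∧ x e ≤ 1}

theorem convex_hyperwebPolyhedron (r l : ℕ) : Convex ℝ (hyperwebPolyhedron r l) := by
  intro x hx y hy a b ha hb hab
  refine ⟨fun Q hQ => ?_, ?_, fun e => ?_⟩
  · rw [UniformHypergraph.edgeSum_add, UniformHypergraph.edgeSum_smul,
      UniformHypergraph.edgeSum_smul]
    exact (convex_Iic (r : ℝ)) (hx.1 Q hQ) (hy.1 Q hQ) ha hb hab
  · have h : ∑ e, (a • x + b • y) e = a • ∑ e, x e + b • ∑ e, y e := by
      simp [Finset.sum_add_distrib, Finset.mul_sum]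
    rw [h]
    exact (convex_Iic ((r : ℝ) * l - ⌈(l : ℝ) / 2⌉)) hx.2.1 hy.2.1 ha hb hab
  · exact (convex_Icc (0 : ℝ) 1) (hx.2.2 e) (hy.2.2 e) ha hb hab

theorem isCompact_hyperwebPolyhedron (r l : ℕ) : IsCompact (hyperwebPolyhedron r l) := by
  refine IsCompact.of_isClosed_subset (isCompact_Icc (a := (0 : (hyperweb r l r).edges → ℝ))
    (b := 1)) ?_ fun x hx => ⟨fun e => (hx.2.2 e).1, fun e => (hx.2.2 e).2⟩
  have h : hyperwebPolyhedron r l =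
      (⋂ Q ∈ (hyperweb r l r).cliques (r + 1), {x | (hyperweb r l r).edgeSum x Q ≤ r}) ∩
      ({x | ∑ e, x e ≤ (r : ℝ) * l - ⌈(l : ℝ) / 2⌉} ∩ Set.Icc 0 1) := by
    ext x
    simp [hyperwebPolyhedron, Pi.le_def, forall_and]
  rw [h]
  refine IsClosed.inter (isClosed_biInter fun Q _ => isClosed_le ?_ continuous_const)
    (IsClosed.inter (isClosed_le (by fun_prop) continuous_const) isClosed_Icc)
  simp_rw [UniformHypergraph.edgeSum_eq_sum_filter]
  fun_prop

theorem turanPolytope_subset_hyperwebPolyhedron {r l : ℕ} (hr : 2 ≤ r) (hl : 2 * (r + 1) ≤ l) :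
    (hyperweb r l r).turanPolytope (r + 1) ⊆ hyperwebPolyhedron r l := by
  have : NeZero r := ⟨by omega⟩
  have : NeZero l := ⟨by omega⟩
  refine convexHull_min ?_ (convex_hyperwebPolyhedron r l)
  rintro x ⟨F, hFH, hF, rfl⟩
  have h1 : ∀ Q ∈ (hyperweb r l r).cliques (r + 1), _ := fun Q hQ =>
    (hyperweb r l r).edgeSum_characteristic_le F hF hQ
  refine ⟨h1, ?_, fun e => by dsimp only; split_ifs <;> simp⟩
  have h2 := two_mul_sum_edges_le hr hl
    (fun j => h1 _ (cyclicInterval_mem_cliques (by omega) j))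
    (fun e => by split_ifs <;> simp)
  rw [Finset.sum_boole] at h2 ⊢
  generalize (Finset.univ.filter fun e : (hyperweb r l r).edges => (e : Finset (Fin l)) ∈ F.edges).card = c at h2 ⊢
  rcases Nat.even_or_odd l with h | h
  · rw [ceil_half_of_even h]
    linarith
  · rw [ceil_half_of_odd h]
    obtain ⟨m, rfl⟩ := h
    have h3 : (2 * c + (2 * m + 1) : ℝ) ≤ 2 * (r * (2 * m + 1)) := by
      push_cast at h2
      linarith
    have h4 : 2 * c + (2 * m + 1) ≤ 2 * (r * (2 * m + 1)) := by exact_mod_cast h3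
    -- Rounding: the left side of `h4` is odd and the right side even.
    have h5 : 2 * c + (2 * m + 1) + 1 ≤ 2 * (r * (2 * m + 1)) := by omega
    have h6 : (2 * c + (2 * m + 1) + 1 : ℝ) ≤ 2 * (r * (2 * m + 1)) := by exact_mod_cast h5
    push_cast
    linarith

/-- An extreme point of the polyhedron is determined by its tight inequalities. -/
theorem eq_zero_of_mem_extremePoints {r l : ℕ} (hr : 2 ≤ r) (hl : 2 * (r + 1) ≤ l)
    {x : (hyperweb r l r).edges → ℝ} (hx : x ∈ (hyperwebPolyhedron r l).extremePoints ℝ)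
    (hweb : Even l ∨ ∑ e, x e < (r : ℝ) * l - ⌈(l : ℝ) / 2⌉)
    {d : (hyperweb r l r).edges → ℝ} (hd : ∀ e, x e = 0 ∨ x e = 1 → d e = 0)
    (hdQ : ∀ Q ∈ (hyperweb r l r).cliques (r + 1), (hyperweb r l r).edgeSum x Q = r →
      (hyperweb r l r).edgeSum d Q = 0) : d = 0 := by
  have : NeZero r := ⟨by omega⟩
  have : NeZero l := ⟨by omega⟩
  -- A strict inequality survives small perturbations; a tight one survives if the direction leaves
  -- it unchanged.
  have aux : ∀ (a b c : ℝ), a ≤ c → (a = c → b = 0) → ∀ᶠ t in nhds (0 : ℝ), a + t * b ≤ c := by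
    intro a b c hac hb
    rcases hac.eq_or_lt with h | h
    · exact Filter.Eventually.of_forall fun t => by simp [hb h, h]
    · have h1 : Filter.Tendsto (fun t : ℝ => a + t * b) (nhds 0) (nhds (a + 0 * b)) :=
        Continuous.tendsto (by fun_prop) 0
      rw [zero_mul, add_zero] at h1
      exact (h1.eventually_lt_const h).mono fun t ht => ht.le
  have hmem : ∀ᶠ t in nhds (0 : ℝ), x + t • d ∈ hyperwebPolyhedron r l := by
    obtain ⟨hxQ, hxW, hxe⟩ := hx.1
    have hQ : ∀ᶠ t in nhds (0 : ℝ), ∀ Q ∈ (hyperweb r l r).cliques (r + 1),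
        (hyperweb r l r).edgeSum (x + t • d) Q ≤ r := by
      rw [Filter.eventually_all]
      intro Q
      rw [Filter.eventually_imp_distrib_left]
      intro hQ
      simp_rw [UniformHypergraph.edgeSum_add, UniformHypergraph.edgeSum_smul]
      exact aux _ _ _ (hxQ Q hQ) (hdQ Q hQ)
    have he : ∀ᶠ t in nhds (0 : ℝ), ∀ e, 0 ≤ (x + t • d) e ∧ (x + t • d) e ≤ 1 := by
      rw [Filter.eventually_all]
      intro e
      refine Filter.Eventually.and ?_ (aux _ _ _ (hxe e).2 fun h => hd e (Or.inr h))
      refine (aux (-x e) (-d e) 0 (by linarith [(hxe e).1])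
        fun h => by rw [hd e (Or.inl (by linarith)), neg_zero]).mono fun t ht => ?_
      simp only [Pi.add_apply, Pi.smul_apply, smul_eq_mul]
      linarith
    have hW : ∀ᶠ t in nhds (0 : ℝ), Even l ∨
        ∑ e, (x + t • d) e ≤ (r : ℝ) * l - ⌈(l : ℝ) / 2⌉ := by
      rcases hweb with h | h
      · exact Filter.Eventually.of_forall fun _ => Or.inl h
      · refine (aux _ (∑ e, d e) _ hxW fun h' => absurd h' h.ne).mono fun t ht => Or.inr ?_
        simpa [Finset.sum_add_distrib, Finset.mul_sum] using ht
    filter_upwards [hQ, he, hW] with t h1 h2 h3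
    refine ⟨h1, ?_, h2⟩
    rcases h3 with h3 | h3
    -- For even `l` the hyperweb inequality follows from the others, so it need not be tracked.
    · have h4 := two_mul_sum_edges_le hr hl
        (fun j => h1 _ (cyclicInterval_mem_cliques (by omega) j)) fun e => (h2 e).2
      rw [ceil_half_of_even h3]
      linarith
    · exact h3
  have hneg : Filter.Tendsto (fun t : ℝ => -t) (nhds 0) (nhds 0) := by
    simpa using (continuous_neg (G := ℝ)).tendsto 0
  have hboth := (hmem.and (hneg.eventually hmem)).filter_mono
    (nhdsWithin_le_nhds (s := Set.Ioi (0 : ℝ)))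
  obtain ⟨t, ⟨h1, h2⟩, ht⟩ := (hboth.and self_mem_nhdsWithin).exists
  have h3 := hx.2 h1 h2 ⟨1 / 2, 1 / 2, by norm_num, by norm_num, by norm_num, by
    ext e
    simp
    ring⟩
  have h4 : t • d = 0 := by simpa using h3
  exact (smul_eq_zero.1 h4).resolve_left (ne_of_gt ht)

/-- It suffices to show that the extreme points of the polyhedron are in the Turán polytope. -/
theorem hyperwebPolyhedron_subset_turanPolytope {r l : ℕ}
    (h : (hyperwebPolyhedron r l).extremePoints ℝ ⊆ (hyperweb r l r).turanPolytope (r + 1)) :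
    hyperwebPolyhedron r l ⊆ (hyperweb r l r).turanPolytope (r + 1) := by
  -- Krein–Milman; the closure is harmless because the Turán polytope has finitely many generators.
  rw [← closure_convexHull_extremePoints (isCompact_hyperwebPolyhedron r l)
    (convex_hyperwebPolyhedron r l)]
  refine closure_minimal (convexHull_min h (convex_convexHull ℝ _)) ?_
  refine Set.Finite.isClosed_convexHull ℝ ?_
  refine Set.Finite.subset (Set.finite_range fun (F : Finset (Finset (Fin l))) =>
    fun e : (hyperweb r l r).edges => if (e : Finset (Fin l)) ∈ F then (1 : ℝ) else 0) ?_
  rintro x ⟨F, -, -, rfl⟩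
  exact ⟨F.edges, rfl⟩

/-- The structure of the fractional support of an extreme point of the polyhedron: it is
a 2-regular incidence structure with the tight cliques that meet it. -/
theorem fractional_support_regular {r l : ℕ} (hr : 2 ≤ r) (hl : 2 * (r + 1) ≤ l)
    {N : Type*} [Fintype N] [DecidableEq N] (cl : N → Finset (Fin l))
    (hcl : ∀ Q, Q ∈ (hyperweb r l r).cliques (r + 1) ↔ ∃ n, cl n = Q)
    (h2 : ∀ e ∈ (hyperweb r l r).edges, (Finset.univ.filter fun n => e ⊆ cl n).card ≤ 2)
    {x : (hyperweb r l r).edges → ℝ} (hx : x ∈ (hyperwebPolyhedron r l).extremePoints ℝ)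
    (hweb : Even l ∨ ∑ e, x e < (r : ℝ) * l - ⌈(l : ℝ) / 2⌉) :
    ∃ (F : Finset (hyperweb r l r).edges) (T : Finset N),
      (∀ e, e ∉ F → x e = 0 ∨ x e = 1) ∧ (∀ e ∈ F, 0 < x e ∧ x e < 1) ∧
      (∀ n ∈ T, (hyperweb r l r).edgeSum x (cl n) = r) ∧
      (∀ e ∈ F, (T.filter fun n => (e : Finset (Fin l)) ⊆ cl n).card = 2) ∧
      (∀ n ∈ T, (F.filter fun e : (hyperweb r l r).edges => (e : Finset (Fin l)) ⊆ cl n).card = 2) ∧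
      ∀ ε : N → ℝ, (∀ n, ε n ≠ 0) →
        (∀ e ∈ F, ∑ n ∈ T.filter fun n => (e : Finset (Fin l)) ⊆ cl n, ε n = 0) → F = ∅ := by
  classical
  let inc : N → Finset (hyperweb r l r).edges := fun n =>
    Finset.univ.filter fun e => (e : Finset (Fin l)) ⊆ cl n
  have hinc : ∀ e n, e ∈ inc n ↔ (e : Finset (Fin l)) ⊆ cl n := fun e n => by simp [inc]
  have hsum : ∀ y n, (hyperweb r l r).edgeSum y (cl n) = ∑ e ∈ inc n, y e := fun y n =>
    UniformHypergraph.edgeSum_eq_sum_filter _ _ _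
  let F : Finset (hyperweb r l r).edges := Finset.univ.filter fun e => 0 < x e ∧ x e < 1
  -- Tight cliques missing the support give trivial equations and are discarded, so that each
  -- remaining one has at least two fractional edges.
  let T : Finset N := Finset.univ.filter fun n => (hyperweb r l r).edgeSum x (cl n) = r ∧
    ((inc n).filter fun e => 0 < x e ∧ x e < 1).Nonempty
  have hF : ∀ e, e ∉ F → x e = 0 ∨ x e = 1 := by
    intro e he
    by_contra! hne
    exact he (Finset.mem_filter.2 ⟨Finset.mem_univ _,
      lt_of_le_of_ne (hx.1.2.2 e).1 (Ne.symm hne.1), lt_of_le_of_ne (hx.1.2.2 e).2 hne.2⟩)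
  have hF' : ∀ e ∈ F, 0 < x e ∧ x e < 1 := fun e he => (Finset.mem_filter.1 he).2
  have hswap : ∀ n, F.filter (fun e => e ∈ inc n) =
      (inc n).filter fun e => 0 < x e ∧ x e < 1 := by
    intro n
    ext e
    simp [F, and_comm]
  have key := card_eq_of_injective_incidence inc F T
    (fun e _ => by
      refine (Finset.card_le_card fun n hn => ?_).trans (h2 e e.2)
      simpa [hinc] using (Finset.mem_filter.1 hn).2)
    (fun n hn => by
      obtain ⟨h3, h4⟩ := (Finset.mem_filter.1 hn).2
      rw [hswap]
      refine two_le_card_fractional (inc n) x r ?_ _ (fun e he => hF e fun h => he (hF' e h))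
        (fun e he => he) h4
      rw [← hsum, h3]
      rfl)
    (fun d hd hdT => by
      refine eq_zero_of_mem_extremePoints hr hl hx hweb (fun e he => hd e fun h => ?_)
        fun Q hQ hQr => ?_
      · rcases he with he | he <;> linarith [hF' e h]
      · obtain ⟨n, rfl⟩ := (hcl Q).1 hQ
        rw [hsum]
        by_cases hne : ((inc n).filter fun e => 0 < x e ∧ x e < 1).Nonempty
        · exact hdT n (Finset.mem_filter.2 ⟨Finset.mem_univ _, hQr, hne⟩)
        · refine Finset.sum_eq_zero fun e he => hd e fun h => hne ⟨e, ?_⟩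
          exact Finset.mem_filter.2 ⟨he, hF' e h⟩)
  simp only [hinc] at key
  exact ⟨F, T, hF, hF', fun n hn => (Finset.mem_filter.1 hn).2.1, key⟩

/-! ### Even cycles and the octahedron -/

/-- If the cliques can be signed such that two cliques sharing an edge have opposite signs, then
the extreme points of the polyhedron are integral. -/
theorem extremePoints_subset_of_bipartite {r l : ℕ} (hr : 2 ≤ r) (hl : 2 * (r + 1) ≤ l)
    (heven : Even l) {N : Type*} [Fintype N] [DecidableEq N] (cl : N → Finset (Fin l))
    (hcl : ∀ Q, Q ∈ (hyperweb r l r).cliques (r + 1) ↔ ∃ n, cl n = Q)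
    (h2 : ∀ e ∈ (hyperweb r l r).edges, (Finset.univ.filter fun n => e ⊆ cl n).card ≤ 2)
    (ε : N → ℤ) (hε : ∀ n, ε n ≠ 0) (hε2 : ∀ e ∈ (hyperweb r l r).edges, ∀ n m, n ≠ m →
      e ⊆ cl n → e ⊆ cl m → ε n + ε m = 0) :
    (hyperwebPolyhedron r l).extremePoints ℝ ⊆ (hyperweb r l r).turanPolytope (r + 1) := by
  intro x hx
  obtain ⟨F, T, hF, -, -, hF2, -, hzero⟩ :=
    fractional_support_regular hr hl cl hcl h2 hx (Or.inl heven)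
  have hempty : F = ∅ := by
    refine hzero (fun n => ε n) (fun n => by exact_mod_cast hε n) fun e he => ?_
    obtain ⟨n, m, hnm, h⟩ := Finset.card_eq_two.1 (hF2 e he)
    have hn : n ∈ T.filter fun n => (e : Finset (Fin l)) ⊆ cl n := by simp [h]
    have hm : m ∈ T.filter fun n => (e : Finset (Fin l)) ⊆ cl n := by simp [h]
    rw [h, Finset.sum_pair hnm]
    exact_mod_cast hε2 e e.2 n m hnm (Finset.mem_filter.1 hn).2 (Finset.mem_filter.1 hm).2
  exact UniformHypergraph.mem_turanPolytope_of_integral _ (fun e => hF e (by simp [hempty])) hx.1.1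

theorem card_cyclicInterval_superset_le {r l : ℕ} [NeZero l] (hr : 2 ≤ r)
    (hl : 2 * (r + 1) ≤ l) {e : Finset (Fin l)} (he : e ∈ (hyperweb r l r).edges) :
    (Finset.univ.filter fun j => e ⊆ cyclicInterval l (r + 1) j).card ≤ 2 := by
  obtain ⟨i, k, hk, rfl⟩ := exists_eq_webEdge hr hl he
  refine (Finset.card_le_card (t := {i, i + 1}) fun j hj => ?_).trans Finset.card_le_two
  rcases (webEdge_subset_iff hr hl i j hk).1 (Finset.mem_filter.1 hj).2 with h | h
  · simp [h]
  · simp [h.1]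

theorem mem_cliques_hyperweb_iff {r l : ℕ} (hr : 2 ≤ r) (hl : 2 * (r + 1) ≤ l)
    (hex : ¬ (r = 2 ∧ l = 6)) (Q : Finset (Fin l)) :
    Q ∈ (hyperweb r l r).cliques (r + 1) ↔ ∃ i, cyclicInterval l (r + 1) i = Q := by
  have : NeZero l := ⟨by omega⟩
  constructor
  · intro hQ
    obtain ⟨i, hi⟩ := exists_eq_cyclicInterval hr hl hex hQ
    exact ⟨i, hi.symm⟩
  · rintro ⟨i, rfl⟩
    exact cyclicInterval_mem_cliques (by omega) i

/-- Alternating signs around the cycle are consistent at the wrap because `l` is even. -/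
theorem extremePoints_subset_of_even {r l : ℕ} (hr : 2 ≤ r) (hl : 2 * (r + 1) ≤ l)
    (heven : Even l) (hex : ¬ (r = 2 ∧ l = 6)) :
    (hyperwebPolyhedron r l).extremePoints ℝ ⊆ (hyperweb r l r).turanPolytope (r + 1) := by
  have : NeZero l := ⟨by omega⟩
  have hpred : ∀ i : Fin l, ((-1 : ℤ)) ^ (i - 1).val + (-1) ^ i.val = 0 := by
    intro i
    rw [val_sub_one_cycle (by omega) i]
    split_ifs with h
    · have : Odd (l - 1) := Nat.Even.sub_odd (by omega) heven odd_one
      simp [h, this.neg_one_pow]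
    · obtain ⟨m, hm⟩ : ∃ m, i.val = m + 1 := ⟨i.val - 1, by omega⟩
      rw [hm, pow_succ]
      simp
  refine extremePoints_subset_of_bipartite hr hl heven (cyclicInterval l (r + 1))
    (mem_cliques_hyperweb_iff hr hl hex) (fun e he => card_cyclicInterval_superset_le hr hl he)
    (fun i => (-1) ^ i.val) (fun i => pow_ne_zero _ (by norm_num)) ?_
  intro e he n m hnm hn hm
  obtain ⟨i, k, hk, rfl⟩ := exists_eq_webEdge hr hl he
  rcases (webEdge_subset_iff hr hl i n hk).1 hn with h1 | h1 <;>
  rcases (webEdge_subset_iff hr hl i m hk).1 hm with h2 | h2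
  · exact absurd (h1.symm.trans h2) hnm
  · rw [← h1, h2.1]
    exact hpred m
  · rw [← h2, h1.1, add_comm]
    exact hpred n
  · exact absurd (sub_left_injective (h1.1.symm.trans h2.1)) hnm

/-- The eight triangles of the octahedron. -/
def octahedronTriangle : Fin 8 → Finset (Fin 6) :=
  ![{0, 1, 2}, {1, 2, 3}, {2, 3, 4}, {3, 4, 5}, {4, 5, 0}, {5, 0, 1}, {0, 2, 4}, {1, 3, 5}]

/-- Here `{0, 2, 4}` and `{1, 3, 5}` are additional cliques. Still each edge lies in at most two
triangles, and the signs are the proper 2-colouring of the faces. -/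
theorem extremePoints_subset_octahedron :
    (hyperwebPolyhedron 2 6).extremePoints ℝ ⊆ (hyperweb 2 6 2).turanPolytope (2 + 1) := by
  refine extremePoints_subset_of_bipartite le_rfl le_rfl (by decide) octahedronTriangle ?_ ?_
    ![1, -1, 1, -1, 1, -1, -1, 1] ?_ ?_
  · have h1 : ∀ Q ∈ Finset.powersetCard 3 (Finset.univ : Finset (Fin 6)),
        Finset.powersetCard 2 Q ⊆ (hyperweb 2 6 2).edges ↔ ∃ n, octahedronTriangle n = Q := by
      decide +kernel
    have h2 : ∀ n, (octahedronTriangle n).card = 3 := by decide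
    intro Q
    constructor
    · intro hQ
      exact (h1 Q (Finset.mem_powersetCard.2 ⟨Finset.subset_univ _, hQ.1⟩)).1 hQ.2
    · rintro ⟨n, rfl⟩
      exact ⟨h2 n, (h1 _ (Finset.mem_powersetCard.2 ⟨Finset.subset_univ _, h2 n⟩)).2 ⟨n, rfl⟩⟩
  · decide +kernel
  · decide +kernel
  · decide +kernel

/-! ### Odd cycles: strict hyperweb inequality -/

theorem sum_eq_zero_add_sum_erase {r : ℕ} [NeZero r] (f : Fin r → ℝ) :
    ∑ k, f k = f 0 + ∑ k ∈ Finset.univ.erase 0, f k :=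
  (Finset.add_sum_erase _ _ (Finset.mem_univ _)).symm

/-- On an odd cycle, extreme points for which the hyperweb inequality is strict are integral. -/
theorem mem_turanPolytope_of_odd_of_lt {r l : ℕ} (hr : 2 ≤ r) (hl : 2 * (r + 1) ≤ l)
    (hodd : Odd l) {x : (hyperweb r l r).edges → ℝ}
    (hx : x ∈ (hyperwebPolyhedron r l).extremePoints ℝ)
    (hweb : ∑ e, x e < (r : ℝ) * l - ⌈(l : ℝ) / 2⌉) :
    x ∈ (hyperweb r l r).turanPolytope (r + 1) := by
  have : NeZero r := ⟨by omega⟩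
  have : NeZero l := ⟨by omega⟩
  have hex : ¬ (r = 2 ∧ l = 6) := by
    rintro ⟨-, rfl⟩
    exact absurd hodd (by decide)
  obtain ⟨F, T, hF, hF', hT, hF2, hT2, -⟩ := fractional_support_regular hr hl
    (cyclicInterval l (r + 1)) (mem_cliques_hyperweb_iff hr hl hex)
    (fun e he => card_cyclicInterval_superset_le hr hl he) hx (Or.inr hweb)
  refine UniformHypergraph.mem_turanPolytope_of_integral _ (fun e => hF e fun he => ?_) hx.1.1
  have hsub := fun i j (k : Fin r) => webEdge_subset_iff hr hl i j k.isLt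
  have hzero : ∀ i k, webEdgeEquiv hr hl (i, k) ∈ F → k = 0 := by
    intro i k h
    by_contra hk
    have hk' : k.val ≠ 0 := fun h' => hk (Fin.ext (by simpa using h'))
    have h1 : (T.filter fun n => (webEdgeEquiv hr hl (i, k) : Finset (Fin l)) ⊆
        cyclicInterval l (r + 1) n) ⊆ {i} := by
      intro j hj
      have h2 := (hsub i j k).1 (Finset.mem_filter.1 hj).2
      simp only [hk', and_false, or_false] at h2
      simp [h2]
    have h3 := Finset.card_le_card h1
    rw [hF2 _ h, Finset.card_singleton] at h3
    omega
  have hTmem : ∀ i, webEdgeEquiv hr hl (i, 0) ∈ F → i ∈ T := by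
    intro i h
    by_contra hi
    have h1 : (T.filter fun n => (webEdgeEquiv hr hl (i, 0) : Finset (Fin l)) ⊆
        cyclicInterval l (r + 1) n) ⊆ {i + 1} := by
      intro j hj
      rcases (hsub i j 0).1 (Finset.mem_filter.1 hj).2 with h2 | h2
      · exact absurd (h2 ▸ (Finset.mem_filter.1 hj).1) hi
      · simp [h2.1]
    have h3 := Finset.card_le_card h1
    rw [hF2 _ h, Finset.card_singleton] at h3
    omega
  -- The tight clique `i` needs a second fractional edge, and its only other shared edge is that of
  -- `i - 1`.
  have hstep : ∀ i, webEdgeEquiv hr hl (i, 0) ∈ F → webEdgeEquiv hr hl (i - 1, 0) ∈ F := by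
    intro i h
    by_contra hi
    have h1 : (F.filter fun e : (hyperweb r l r).edges => (e : Finset (Fin l)) ⊆
        cyclicInterval l (r + 1) i) ⊆ {webEdgeEquiv hr hl (i, 0)} := by
      intro e he
      obtain ⟨⟨j, k⟩, rfl⟩ := (webEdgeEquiv hr hl).surjective e
      obtain ⟨he1, he2⟩ := Finset.mem_filter.1 he
      obtain rfl := hzero j k he1
      rcases (hsub j i 0).1 he2 with h2 | h2
      · simp [h2]
      · exact absurd (h2.1 ▸ he1) hi
    have h3 := Finset.card_le_card h1
    rw [hT2 i (hTmem i h), Finset.card_singleton] at h3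
    omega
  obtain ⟨⟨i, k⟩, rfl⟩ := (webEdgeEquiv hr hl).surjective e
  obtain rfl := hzero i k he
  -- Descend to 0, wrap around to `l - 1`, and descend to any `j`.
  have hall : ∀ j, webEdgeEquiv hr hl (j, 0) ∈ F := by
    have h0 : ∀ n : ℕ, ∀ j : Fin l, j.val = n → webEdgeEquiv hr hl (j, 0) ∈ F →
        webEdgeEquiv hr hl (0, 0) ∈ F := by
      intro n
      induction n with
      | zero =>
        intro j hj h
        obtain rfl : j = 0 := Fin.ext hj
        exact h
      | succ n ih =>
        intro j hj h
        refine ih (j - 1) ?_ (hstep j h)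
        rw [val_sub_one_cycle (by omega) j, if_neg (by omega)]
        omega
    have h1 := hstep 0 (h0 _ i rfl he)
    have h2 : ∀ n : ℕ, ∀ j : Fin l, j.val + n + 1 = l → webEdgeEquiv hr hl (j, 0) ∈ F := by
      intro n
      induction n with
      | zero =>
        intro j hj
        have : j = 0 - 1 := by
          rw [Fin.ext_iff, val_sub_one_cycle (by omega)]
          simp
          omega
        exact this ▸ h1
      | succ n ih =>
        intro j hj
        have h3 := hstep ⟨j.val + 1, by omega⟩ (ih _ (by simp; omega))
        have : j = ⟨j.val + 1, by omega⟩ - 1 := by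
          rw [Fin.ext_iff, val_sub_one_cycle (by omega)]
          simp
        exact this ▸ h3
    exact fun j => h2 (l - 1 - j.val) j (by have := j.isLt; omega)
  have hsum : ∀ j, (r : ℝ) - 1 ≤ ∑ k ∈ Finset.univ.erase 0, x (webEdgeEquiv hr hl (j, k)) ∧
      (hyperweb r l r).edgeSum x (cyclicInterval l (r + 1) j) = r := by
    intro j
    have h1 := hT j (hTmem j (hall j))
    refine ⟨?_, h1⟩
    rw [edgeSum_cyclicInterval hr hl, sum_eq_zero_add_sum_erase] at h1
    have h2 := hF' _ (hall j)
    have h3 := hF' _ (hall (j - 1))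
    have h4 : ∑ k ∈ Finset.univ.erase 0, x (webEdgeEquiv hr hl (j, k)) =
        ((∑ k ∈ Finset.univ.erase (0 : Fin r),
          if x (webEdgeEquiv hr hl (j, k)) = 0 then 0 else 1 : ℤ) : ℝ) := by
      push_cast
      refine Finset.sum_congr rfl fun k hk => ?_
      rcases hF (webEdgeEquiv hr hl (j, k))
        (fun h => (Finset.mem_erase.1 hk).1 (hzero j k h)) with h | h <;> simp [h]
    rw [h4] at h1 ⊢
    generalize (∑ k ∈ Finset.univ.erase (0 : Fin r),
          if x (webEdgeEquiv hr hl (j, k)) = 0 then 0 else 1 : ℤ) = m at h1 ⊢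
    -- The clique sum is `r` and its two shared edges contribute less than 2, so the integer private
    -- part is at least `r - 1`.
    have h5 : ((r : ℤ) : ℝ) - 2 < m := by
      push_cast
      linarith
    have h6 : (r : ℤ) - 2 < m := by exact_mod_cast h5
    have h7 : (r : ℤ) - 1 ≤ m := by omega
    exact_mod_cast h7
  have h1 := sum_edgeSum_cyclicInterval hr hl x
  have h2 : ∑ e, x e = ∑ i, x (webEdgeEquiv hr hl (i, 0)) +
      ∑ i, ∑ k ∈ Finset.univ.erase 0, x (webEdgeEquiv hr hl (i, k)) := by
    rw [sum_hyperweb_edges hr hl, ← Finset.sum_add_distrib]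
    exact Finset.sum_congr rfl fun i _ => sum_eq_zero_add_sum_erase _
  have h3 := Finset.sum_le_sum fun j (_ : j ∈ Finset.univ) => (hsum j).1
  simp only [(hsum _).2, Finset.sum_const, Finset.card_univ, Fintype.card_fin,
    nsmul_eq_mul] at h1 h3
  rw [ceil_half_of_odd hodd] at hweb
  -- With `S`, `P` the shared and private totals, `2S + P = r l` and `P ≥ (r - 1) l` give `S + P ≥ r
  -- l - l / 2`, too large.
  linarith

/-! ### Odd cycles: the face of the hyperweb inequality -/

/-- The integral points on which the hyperweb inequality for an odd cycle is tight, in the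
coordinates of `webEdgeEquiv`. -/
noncomputable def webVertexCoord (r l : ℕ) [NeZero r] [NeZero l] (p q : Fin l × Fin r) : ℝ :=
  if q.2 = 0 then (if (Odd (q.1 - p.1).val ↔ p.2 = 0) then 1 else 0) else if q = p then 0 else 1

/-- Shared values alternate, except that those of the two shared edges in clique `p.1` agree since
`l` is odd: both are 0 if `p.2 = 0`, and both 1 otherwise, offset by the missing private edge `p`.
-/
theorem webVertexCoord_clique {r l : ℕ} [NeZero r] [NeZero l] (hl : 2 ≤ l) (hodd : Odd l)
    (p : Fin l × Fin r) (j : Fin l) :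
    ∑ k : Fin r, webVertexCoord r l p (j, k) + webVertexCoord r l p (j - 1, 0) =
      r - if (j, 0) = p then 1 else 0 := by
  obtain ⟨i, m⟩ := p
  have h1 : ∑ k ∈ Finset.univ.erase (0 : Fin r), webVertexCoord r l (i, m) (j, k) =
      (r : ℝ) - 1 - if j = i ∧ m ≠ 0 then 1 else 0 := by
    have h2 : ∀ k ∈ Finset.univ.erase (0 : Fin r), webVertexCoord r l (i, m) (j, k) =
        1 - if k = m then (if j = i then 1 else 0) else 0 := by
      intro k hk
      simp only [webVertexCoord, (Finset.mem_erase.1 hk).1, if_false, Prod.mk.injEq]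
      by_cases h : k = m <;> by_cases h' : j = i <;> simp [h, h']
    rw [Finset.sum_congr rfl h2, Finset.sum_sub_distrib, Finset.sum_ite_eq']
    have hr : 1 ≤ r := NeZero.one_le
    by_cases h : m = 0 <;> by_cases h' : j = i <;>
      simp [h, h', Finset.card_erase_of_mem, Nat.cast_sub hr]
  have h3 : webVertexCoord r l (i, m) (j, 0) + webVertexCoord r l (i, m) (j - 1, 0) =
      1 + (if j = i then (if m = 0 then -1 else 1) else 0) := by
    have h4 : (j - 1 - i).val = if (j - i).val = 0 then l - 1 else (j - i).val - 1 := by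
      rw [sub_right_comm, val_sub_one_cycle hl]
    have h5 : Even (l - 1) := Nat.Odd.sub_odd hodd odd_one
    simp only [webVertexCoord, if_true, h4]
    by_cases h : j = i
    · subst h
      by_cases hm : m = 0 <;> simp [hm, h5]
    · have h6 : (j - i).val ≠ 0 := fun h' => h (sub_eq_zero.1 (Fin.ext h'))
      obtain ⟨n, hn⟩ : ∃ n, (j - i).val = n + 1 := ⟨(j - i).val - 1, by omega⟩
      rw [hn]
      by_cases hm : m = 0 <;> by_cases ho : Even n <;>
        simp [hm, h, ho, Nat.odd_add_one]
  rw [sum_eq_zero_add_sum_erase, h1, add_right_comm, h3]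
  by_cases h : m = 0 <;> by_cases h' : j = i <;> simp [h, h', Prod.ext_iff, eq_comm]

/-- Going once around an odd cycle gives `f 0 = -f 0`. -/
theorem eq_zero_of_add_pred_eq_zero {l : ℕ} [NeZero l] (hl : 2 ≤ l) (hodd : Odd l)
    {f : Fin l → ℝ} (h : ∀ i, f i + f (i - 1) = 0) : f = 0 := by
  have h1 : ∀ n : ℕ, ∀ i : Fin l, i.val = n → f i = (-1) ^ n * f 0 := by
    intro n
    induction n with
    | zero =>
      intro i hi
      obtain rfl : i = 0 := Fin.ext hi
      simp
    | succ n ih =>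
      intro i hi
      have h2 := ih (i - 1) (by rw [val_sub_one_cycle hl, if_neg (by omega)]; omega)
      have h3 := h i
      rw [h2] at h3
      rw [pow_succ]
      linarith
  have h2 := h1 (l - 1) (0 - 1) (by rw [val_sub_one_cycle hl]; simp)
  have h3 : Even (l - 1) := Nat.Odd.sub_odd hodd odd_one
  have h4 := h 0
  rw [h2, h3.neg_one_pow] at h4
  have h5 : f 0 = 0 := by linarith
  ext i
  simp [h1 _ i rfl, h5]

/-- On an odd cycle, the face of the hyperweb inequality is spanned by its integral points. -/
theorem mem_turanPolytope_of_odd_of_eq {r l : ℕ} (hr : 2 ≤ r) (hl : 2 * (r + 1) ≤ l)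
    (hodd : Odd l) {x : (hyperweb r l r).edges → ℝ} (hx : x ∈ hyperwebPolyhedron r l)
    (hweb : ∑ e, x e = (r : ℝ) * l - ⌈(l : ℝ) / 2⌉) :
    x ∈ (hyperweb r l r).turanPolytope (r + 1) := by
  have : NeZero r := ⟨by omega⟩
  have : NeZero l := ⟨by omega⟩
  have hex : ¬ (r = 2 ∧ l = 6) := by
    rintro ⟨-, rfl⟩
    exact absurd hodd (by decide)
  have hl2 : 2 ≤ l := by omega
  let V : Fin l × Fin r → (hyperweb r l r).edges → ℝ := fun p e =>
    webVertexCoord r l p ((webEdgeEquiv hr hl).symm e)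
  have hV : ∀ p q, V p (webEdgeEquiv hr hl q) = webVertexCoord r l p q := fun p q => by simp [V]
  have hVQ : ∀ p j, (hyperweb r l r).edgeSum (V p) (cyclicInterval l (r + 1) j) =
      r - if (j, 0) = p then 1 else 0 := fun p j => by
    rw [edgeSum_cyclicInterval hr hl]
    simp only [hV]
    exact webVertexCoord_clique hl2 hodd p j
  have hVmem : ∀ p, V p ∈ (hyperweb r l r).turanPolytope (r + 1) := by
    intro p
    refine UniformHypergraph.mem_turanPolytope_of_integral _ (fun e => ?_) fun Q hQ => ?_
    · simp only [V, webVertexCoord]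
      split_ifs <;> simp
    · obtain ⟨j, rfl⟩ := (mem_cliques_hyperweb_iff hr hl hex Q).1 hQ
      rw [hVQ]
      split_ifs <;> simp
  -- The point `V p` has slack 1 in the inequality indexed by `p` and slack 0 in the others, so the
  -- weights must be the slacks of `x`.
  let w : Fin l × Fin r → ℝ := fun p => if p.2 = 0 then
    r - (hyperweb r l r).edgeSum x (cyclicInterval l (r + 1) p.1)
    else 1 - x (webEdgeEquiv hr hl p)
  have hw : ∀ p, 0 ≤ w p := by
    intro p
    simp only [w]
    split_ifs
    · linarith [hx.1 _ (cyclicInterval_mem_cliques (by omega) p.1)]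
    · linarith [(hx.2.2 (webEdgeEquiv hr hl p)).2]
  have hw1 : ∑ p, w p = 1 := by
    have h1 := sum_edgeSum_cyclicInterval hr hl x
    have h2 : ∑ e, x e = ∑ i, x (webEdgeEquiv hr hl (i, 0)) +
        ∑ i, ∑ k ∈ Finset.univ.erase 0, x (webEdgeEquiv hr hl (i, k)) := by
      rw [sum_hyperweb_edges hr hl, ← Finset.sum_add_distrib]
      exact Finset.sum_congr rfl fun i _ => sum_eq_zero_add_sum_erase _
    have h3 : ∀ i, ∑ k, w (i, k) =
        (r - (hyperweb r l r).edgeSum x (cyclicInterval l (r + 1) i)) + ((r - 1) -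
          ∑ k ∈ Finset.univ.erase 0, x (webEdgeEquiv hr hl (i, k))) := by
      intro i
      rw [sum_eq_zero_add_sum_erase]
      congr 1
      have h4 : ∀ k ∈ Finset.univ.erase (0 : Fin r), w (i, k) =
          1 - x (webEdgeEquiv hr hl (i, k)) := fun k hk => by
        simp [w, (Finset.mem_erase.1 hk).1]
      rw [Finset.sum_congr rfl h4, Finset.sum_sub_distrib]
      simp [Finset.card_erase_of_mem, Nat.cast_sub (show 1 ≤ r by omega)]
    rw [Fintype.sum_prod_type]
    simp_rw [h3, Finset.sum_add_distrib, Finset.sum_sub_distrib]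
    rw [ceil_half_of_odd hodd] at hweb
    simp only [Finset.sum_const, Finset.card_univ, Fintype.card_fin, nsmul_eq_mul]
    linarith
  let z : (hyperweb r l r).edges → ℝ := ∑ p, w p • V p
  have hz : ∀ e, z e = ∑ p, w p * V p e := fun e => by simp [z]
  have hzmem : z ∈ (hyperweb r l r).turanPolytope (r + 1) :=
    (convex_convexHull ℝ _).sum_mem (fun p _ => hw p) hw1 fun p _ => hVmem p
  have hpriv : ∀ i k, k ≠ 0 → z (webEdgeEquiv hr hl (i, k)) = x (webEdgeEquiv hr hl (i, k)) := by
    intro i k hk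
    have h1 : ∀ p, w p * V p (webEdgeEquiv hr hl (i, k)) =
        w p - if (i, k) = p then w p else 0 := by
      intro p
      rw [hV]
      simp only [webVertexCoord, hk, if_false]
      split_ifs <;> simp
    rw [hz]
    simp_rw [h1]
    rw [Finset.sum_sub_distrib, hw1, Finset.sum_ite_eq]
    simp [w, hk]
  have hzQ : ∀ j, (hyperweb r l r).edgeSum z (cyclicInterval l (r + 1) j) =
      (hyperweb r l r).edgeSum x (cyclicInterval l (r + 1) j) := by
    intro j
    have h1 : (hyperweb r l r).edgeSum z (cyclicInterval l (r + 1) j) =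
        ∑ p, w p * (hyperweb r l r).edgeSum (V p) (cyclicInterval l (r + 1) j) := by
      simp only [UniformHypergraph.edgeSum_eq_sum_filter, hz, Finset.mul_sum]
      exact Finset.sum_comm
    have h2 : ∀ p, w p * ((r : ℝ) - if (j, 0) = p then 1 else 0) =
        w p * r - if (j, 0) = p then w p else 0 := by
      intro p
      split_ifs <;> ring
    rw [h1]
    simp_rw [hVQ, h2]
    rw [Finset.sum_sub_distrib, ← Finset.sum_mul, hw1, Finset.sum_ite_eq]
    simp [w]
  -- Equal clique sums and private values leave a difference whose neighbouring shared values
  -- cancel.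
  have hshared : (fun j => z (webEdgeEquiv hr hl (j, 0)) - x (webEdgeEquiv hr hl (j, 0))) = 0 := by
    refine eq_zero_of_add_pred_eq_zero hl2 hodd fun j => ?_
    have h1 := hzQ j
    rw [edgeSum_cyclicInterval hr hl, edgeSum_cyclicInterval hr hl, sum_eq_zero_add_sum_erase,
      sum_eq_zero_add_sum_erase (fun k => x (webEdgeEquiv hr hl (j, k))),
      Finset.sum_congr rfl fun k hk => hpriv j k (Finset.mem_erase.1 hk).1] at h1
    linarith
  have hzx : z = x := by
    ext e
    obtain ⟨⟨i, k⟩, rfl⟩ := (webEdgeEquiv hr hl).surjective e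
    by_cases hk : k = 0
    · subst hk
      exact sub_eq_zero.1 (congrFun hshared i)
    · exact hpriv i k hk
  exact hzx ▸ hzmem

/-! ### The description and the necessity of each inequality -/

theorem turanPolytope_hyperweb {r l : ℕ} (hr : 2 ≤ r) (hl : 2 * (r + 1) ≤ l) :
    (hyperweb r l r).turanPolytope (r + 1) = hyperwebPolyhedron r l := by
  refine (turanPolytope_subset_hyperwebPolyhedron hr hl).antisymm
    (hyperwebPolyhedron_subset_turanPolytope ?_)
  rcases Nat.even_or_odd l with h | h
  · by_cases hex : r = 2 ∧ l = 6
    · obtain ⟨rfl, rfl⟩ := hex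
      exact extremePoints_subset_octahedron
    · exact extremePoints_subset_of_even hr hl h hex
  · intro x hx
    rcases hx.1.2.1.lt_or_eq with h1 | h1
    · exact mem_turanPolytope_of_odd_of_lt hr hl h hx h1
    · exact mem_turanPolytope_of_odd_of_eq hr hl h hx.1 h1

theorem not_mem_turanPolytope_of_not_holds {r l : ℕ} (hr : 2 ≤ r) (hl : 2 * (r + 1) ≤ l)
    {x : (hyperweb r l r).edges → ℝ} (i : HyperwebInequality r l) (h : ¬ i.Holds x) :
    x ∉ (hyperweb r l r).turanPolytope (r + 1) := by
  rw [turanPolytope_hyperweb hr hl]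
  intro hx
  apply h
  cases i with
  | clique Q hQ => exact hx.1 Q hQ
  | web => exact hx.2.1
  | nonneg e => exact (hx.2.2 e).1
  | edge e => exact (hx.2.2 e).2

theorem edgeSum_single {r l : ℕ} (e : (hyperweb r l r).edges) (c : ℝ) (Q : Finset (Fin l)) :
    (hyperweb r l r).edgeSum (Pi.single e c) Q = if (e : Finset (Fin l)) ⊆ Q then c else 0 := by
  rw [UniformHypergraph.edgeSum, Finset.sum_eq_single e]
  · simp
  · intro f _ hf
    simp [Pi.single_eq_of_ne hf]
  · simp

theorem two_le_hyperweb_bound {r l : ℕ} (hr : 2 ≤ r) (hl : 2 * (r + 1) ≤ l) (hodd : Odd l) :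
    (2 : ℝ) ≤ (r : ℝ) * l - ⌈(l : ℝ) / 2⌉ := by
  rw [ceil_half_of_odd hodd]
  have h1 : (2 : ℝ) ≤ r := by exact_mod_cast hr
  have h2 : (6 : ℝ) ≤ l := by exact_mod_cast (show 6 ≤ l by omega)
  nlinarith

theorem exists_violating_only {r l : ℕ} (hr : 2 ≤ r) (hl : 2 * (r + 1) ≤ l) (hodd : Odd l)
    (i : HyperwebInequality r l) :
    ∃ x, ¬ i.Holds x ∧ ∀ j : HyperwebInequality r l, j ≠ i → j.Holds x := by
  have : NeZero r := ⟨by omega⟩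
  have : NeZero l := ⟨by omega⟩
  have hex : ¬ (r = 2 ∧ l = 6) := by
    rintro ⟨-, rfl⟩
    exact absurd hodd (by decide)
  have hr2 : (2 : ℝ) ≤ r := by exact_mod_cast hr
  have hl6 : (6 : ℝ) ≤ l := by exact_mod_cast (show 6 ≤ l by omega)
  have hbound := two_le_hyperweb_bound hr hl hodd
  cases i with
  | clique Q hQ =>
    obtain ⟨i, rfl⟩ := (mem_cliques_hyperweb_iff hr hl hex Q).1 hQ
    let one : Fin r := ⟨1, by omega⟩
    have h10 : (0 : Fin r) ≠ one := fun h => by simpa [one] using congrArg Fin.val h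
    -- Delete one private edge from every clique but `i`: the total `r l - (l - 1)` respects the
    -- hyperweb bound.
    let y : Fin l × Fin r → ℝ := fun p => 1 - if p.2 = one then (if p.1 = i then 0 else 1) else 0
    let x : (hyperweb r l r).edges → ℝ := fun e => y ((webEdgeEquiv hr hl).symm e)
    have hy : ∀ j, ∑ k, y (j, k) = r - if j = i then 0 else 1 := fun j => by
      simp [y, Finset.sum_sub_distrib]
    have hxQ : ∀ j, (hyperweb r l r).edgeSum x (cyclicInterval l (r + 1) j) =
        r + if j = i then 1 else 0 := by
      intro j
      rw [edgeSum_cyclicInterval hr hl]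
      simp only [x, Equiv.symm_apply_apply, hy]
      have : y (j - 1, 0) = 1 := by simp [y, h10]
      rw [this]
      split_ifs <;> ring
    refine ⟨x, fun h => ?_, fun j hj => ?_⟩
    · simp only [HyperwebInequality.Holds, hxQ, if_true] at h
      linarith
    · cases j with
      | clique Q' hQ' =>
        obtain ⟨j, rfl⟩ := (mem_cliques_hyperweb_iff hr hl hex Q').1 hQ'
        have hji : j ≠ i := by
          rintro rfl
          exact hj rfl
        simp [HyperwebInequality.Holds, hxQ, hji]
      | web =>
        simp only [HyperwebInequality.Holds]
        rw [sum_hyperweb_edges hr hl, ceil_half_of_odd hodd]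
        simp only [x, Equiv.symm_apply_apply, hy]
        have h1 : ∀ j : Fin l, ((r : ℝ) - if j = i then 0 else 1) =
            (r - 1) + if j = i then 1 else 0 := fun j => by split_ifs <;> ring
        simp_rw [h1]
        rw [Finset.sum_add_distrib]
        simp
        linarith
      | nonneg e =>
        simp only [HyperwebInequality.Holds, x, y]
        split_ifs <;> norm_num
      | edge e =>
        simp only [HyperwebInequality.Holds, x, y]
        split_ifs <;> norm_num
  | web =>
    -- Shared edges get 1/2, so all cliques are tight and the total `r l - l / 2` beats the rounded
    -- bound.
    let y : Fin l × Fin r → ℝ := fun p => 1 - if p.2 = 0 then 1 / 2 else 0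
    let x : (hyperweb r l r).edges → ℝ := fun e => y ((webEdgeEquiv hr hl).symm e)
    have hy : ∀ j, ∑ k, y (j, k) = r - 1 / 2 := fun j => by
      simp [y, Finset.sum_sub_distrib]
    refine ⟨x, fun h => ?_, fun j hj => ?_⟩
    · simp only [HyperwebInequality.Holds] at h
      rw [sum_hyperweb_edges hr hl, ceil_half_of_odd hodd] at h
      simp only [x, Equiv.symm_apply_apply, hy, Finset.sum_const, Finset.card_univ,
        Fintype.card_fin, nsmul_eq_mul] at h
      linarith
    · cases j with
      | clique Q hQ =>
        obtain ⟨j, rfl⟩ := (mem_cliques_hyperweb_iff hr hl hex Q).1 hQ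
        simp only [HyperwebInequality.Holds]
        rw [edgeSum_cyclicInterval hr hl]
        simp only [x, Equiv.symm_apply_apply, y]
        norm_num
      | web => exact absurd rfl hj
      | nonneg e =>
        simp only [HyperwebInequality.Holds, x, y]
        split_ifs <;> norm_num
      | edge e =>
        simp only [HyperwebInequality.Holds, x, y]
        split_ifs <;> norm_num
  | nonneg e =>
    refine ⟨Pi.single e (-1), fun h => ?_, fun j hj => ?_⟩
    · simp only [HyperwebInequality.Holds, Pi.single_eq_same] at h
      linarith
    · cases j with
      | clique Q hQ =>
        simp only [HyperwebInequality.Holds, edgeSum_single]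
        split_ifs <;> linarith
      | web =>
        simp only [HyperwebInequality.Holds]
        rw [Finset.sum_pi_single']
        simp
        linarith
      | nonneg f =>
        have hfe : f ≠ e := by
          rintro rfl
          exact hj rfl
        simp [HyperwebInequality.Holds, Pi.single_eq_of_ne hfe]
      | edge f =>
        simp only [HyperwebInequality.Holds, Pi.single_apply]
        split_ifs <;> norm_num
  | edge e =>
    -- The value 2 is allowed in a clique because `r ≥ 2`.
    refine ⟨Pi.single e 2, fun h => ?_, fun j hj => ?_⟩
    · simp only [HyperwebInequality.Holds, Pi.single_eq_same] at h
      linarith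
    · cases j with
      | clique Q hQ =>
        simp only [HyperwebInequality.Holds, edgeSum_single]
        split_ifs <;> linarith
      | web =>
        simp only [HyperwebInequality.Holds]
        rw [Finset.sum_pi_single']
        simp
        linarith
      | nonneg f =>
        simp only [HyperwebInequality.Holds, Pi.single_apply]
        split_ifs <;> norm_num
      | edge f =>
        have hfe : f ≠ e := by
          rintro rfl
          exact hj rfl
        simp [HyperwebInequality.Holds, Pi.single_eq_of_ne hfe]

theorem mainTheorem12 (r l : ℕ) (hr : 2 ≤ r) (hl : 2 * (r + 1) ≤ l) :
    (hyperweb r l r).turanPolytope (r + 1) =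
        {x | (∀ Q ∈ (hyperweb r l r).cliques (r + 1), (hyperweb r l r).edgeSum x Q ≤ r) ∧
          ∑ e, x e ≤ (r : ℝ) * l - ⌈(l : ℝ) / 2⌉ ∧
          ∀ e, 0 ≤ x e ∧ x e ≤ 1} ∧
      (Odd l → ∀ i : HyperwebInequality r l,
        ∃ x, x ∉ (hyperweb r l r).turanPolytope (r + 1) ∧
          ∀ j : HyperwebInequality r l, j ≠ i → j.Holds x) := by
  refine ⟨turanPolytope_hyperweb hr hl, fun hodd i => ?_⟩
  obtain ⟨x, hx, hj⟩ := exists_violating_only hr hl hodd i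
  exact ⟨x, not_mem_turanPolytope_of_not_holds hr hl i hx, hj⟩
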